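/- Theorem 1.2. Let $S_4$ be a 4-simplex in Euclidean space $\mathbb{E}^4$, i.e. the convex hull of five affinely independent points (in particular, $S_4$ may be a regular simplex). If $\Lambda\subset\mathbb{E}^4$ is a lattice (the set of integer linear combinations of four linearly independent vectors) such that $S_4+\Lambda$ is a lattice covering of $\mathbb{E}^4$, i.e. $\mathbb{E}^4=\bigcup_{\mathbf{v}\in\Lambda}(S_4+\mathbf{v})$, then its density $\mathrm{vol}(S_4)/d(\Lambda)$, where $d(\Lambda)$ is the determinant of $\Lambda$ (the volume of a fundamental parallelepiped), satisfies $$\frac{\mathrm{vol}(S_4)}{d(\Lambda)}\ \geq\ \frac{343}{264}.$$ In other words, the lattice covering density $\theta^l(S_4)$, the infimum of $\mathrm{vol}(S_4)/d(\Lambda)$ over the (nonempty) family of all lattices $\Lambda$ such that $S_4+\Lambda$ is a lattice covering of $\mathbb{E}^4$, satisfies $$\theta^l(S_4)\geq \frac{343}{264}.$$ -/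

import Mathlib

open MeasureTheory

/-- `K + Λ` is a lattice covering of `𝔼ⁿ`: the translates `K + v`, `v ∈ Λ`, cover the space. -/
def IsLatticeCovering {n : ℕ} (K : Set (EuclideanSpace ℝ (Fin n)))
    (Λ : Submodule ℤ (EuclideanSpace ℝ (Fin n))) : Prop :=
  (⋃ v ∈ Λ, (fun x => x + v) '' K) = Set.univ

/-- The density `θ(K, Λ) = vol(K) / d(Λ)`, where the determinant `d(Λ)` of the lattice `Λ` is its
covolume, that is, `|det A|` for a matrix `A` whose rows are a `ℤ`-basis of `Λ`. -/
noncomputable def coveringDensity {n : ℕ} (K : Set (EuclideanSpace ℝ (Fin n)))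
    (Λ : Submodule ℤ (EuclideanSpace ℝ (Fin n))) : ℝ :=
  volume.real K / ZLattice.covolume Λ volume

/-- The densities of all lattice coverings `K + Λ` of `𝔼ⁿ`, where `Λ` runs over the lattices of
full rank (discrete subgroups that span `𝔼ⁿ` over `ℝ`). -/
def latticeCoveringDensities {n : ℕ} (K : Set (EuclideanSpace ℝ (Fin n))) : Set ℝ :=
  {θ | ∃ (Λ : Submodule ℤ (EuclideanSpace ℝ (Fin n))) (_ : DiscreteTopology Λ)
      (_ : IsZLattice ℝ Λ), IsLatticeCovering K Λ ∧ θ = coveringDensity K Λ}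

/-- The lattice covering density `θˡ(K)`: the smallest density of a lattice covering `K + Λ`.
All densities are nonnegative, so the set is bounded below; a positive lower bound for this real
infimum includes that lattice coverings with `K` exist. -/
noncomputable def latticeCoveringDensity {n : ℕ} (K : Set (EuclideanSpace ℝ (Fin n))) : ℝ :=
  sInf (latticeCoveringDensities K)

/-! The proof replaces a covering by a tiling. In coordinates adapted to the simplex, the simplex is
`Δ = {x | 0 ≤ x, ∑ xᵢ ≤ 1}` of volume `1 / 24`. Choose in every class modulo the lattice `Γ` the
point of the nonnegative orthant with the smallest coordinate sum (ties are broken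
lexicographically, see `key`). If the translates of `Δ` cover, these points form a set `tile Γ`
inside `Δ` whose translates cover too, so the covolume is at most the volume of the tile, and it
suffices to show that this volume is at most `11 / 343` (`volume_tile_le`).

The tile is a down-set in the orthant. Fix the last two coordinates `c`; the slice over `c` is then
a planar staircase. The heart of the matter is that such a staircase has on average at most one inner
corner (`tsum_volume_cornerSet_le`): an inner corner is the apex of the slice of another translate
of the tile, and no apex arises twice, since the difference of the two lattice vectors, with the
right sign, would cut off one of the two corners (`not_mem_cornerSet_of_key_lt`). All parameters `c`
lie in a triangle of area `1 / 2`.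

Now consider the part of the tile at height `1 - δ`. As the tile ends at height `1`, every point of
it is within `δ` of the end of its row, and that end lies above an inner corner or is the end of the
slice on the axis (`exists_corner`). This bounds the section by `δ / 2 + δ (1 - δ)² / 2`
(`volume_tileSection_le`), while trivially it is at most `(1 - δ)³ / 6`. Integrating the former
bound over `δ ≤ 1 / 7` and the latter over `δ ≥ 1 / 7` gives `1831 / 57624 < 11 / 343`. -/

open Set

/-! ### The staircase tile of a lattice in coordinates -/

/-- The sum of the coordinates of a point of `ℝ⁴`, written as `(b, a, c)` with `c ∈ ℝ²`. -/
def height (x : ℝ × ℝ × ℝ × ℝ) : ℝ := x.1 + (x.2.1 + x.2.2.1 + x.2.2.2)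

/-- The height, refined to an injective additive map into a linearly ordered group: ties are broken
lexicographically by the first three coordinates, which together with the height determine the
point. -/
def key : (ℝ × ℝ × ℝ × ℝ) →+ (ℝ ×ₗ ℝ ×ₗ ℝ ×ₗ ℝ) where
  toFun x := toLex (height x, toLex (x.1, toLex (x.2.1, x.2.2.1)))
  map_zero' := by simp only [height, Prod.fst_zero, Prod.snd_zero, add_zero]; rfl
  map_add' x y := by
    have : height (x + y) = height x + height y := by
      simp only [height, Prod.fst_add, Prod.snd_add]; ring
    rw [this]; rfl

lemma height_add (x y : ℝ × ℝ × ℝ × ℝ) : height (x + y) = height x + height y := by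
  simp only [height, Prod.fst_add, Prod.snd_add]; ring

lemma height_sub (x y : ℝ × ℝ × ℝ × ℝ) : height (x - y) = height x - height y := by
  simp only [height, Prod.fst_sub, Prod.snd_sub]; ring

lemma key_injective : Function.Injective key := by
  intro x y h
  have h' : (height x, x.1, x.2.1, x.2.2.1) = (height y, y.1, y.2.1, y.2.2.1) := h
  simp only [height, Prod.mk.injEq] at h'
  obtain ⟨h0, h1, h2, h3⟩ := h'
  ext <;> linarith

lemma key_pos_of_height_pos {x : ℝ × ℝ × ℝ × ℝ} (h : 0 < height x) : 0 < key x :=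
  (Prod.Lex.toLex_lt_toLex (x := (0, toLex (0, toLex (0, 0))))).2 (Or.inl h)

lemma height_nonneg_of_key_pos {x : ℝ × ℝ × ℝ × ℝ} (h : 0 < key x) : 0 ≤ height x := by
  have h' : toLex ((0 : ℝ), toLex ((0 : ℝ), toLex ((0 : ℝ), (0 : ℝ)))) <
    toLex (height x, toLex (x.1, toLex (x.2.1, x.2.2.1))) := h
  rcases Prod.Lex.toLex_lt_toLex.1 h' with h | h
  · exact le_of_lt h
  · exact le_of_eq h.1

/-- The points of the nonnegative orthant that have the smallest `key` in their class modulo `Γ`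
within that orthant; equivalently, no positive lattice vector lies below them. -/
def tile (Γ : AddSubgroup (ℝ × ℝ × ℝ × ℝ)) : Set (ℝ × ℝ × ℝ × ℝ) :=
  {x | 0 ≤ x ∧ ∀ v ∈ Γ, 0 < key v → ¬ v ≤ x}

/-- Finiteness of the lattice vectors below a point and above a level. -/
lemma finite_below {Γ : AddSubgroup (ℝ × ℝ × ℝ × ℝ)} (hf : ∀ x y, ((Γ : Set (ℝ × ℝ × ℝ × ℝ)) ∩ Icc x y).Finite)
    (x : ℝ × ℝ × ℝ × ℝ) (r : ℝ) : {v | v ∈ Γ ∧ v ≤ x ∧ r ≤ height v}.Finite := by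
  refine (hf (r - height x + x.1, r - height x + x.2.1, r - height x + x.2.2.1,
    r - height x + x.2.2.2) x).subset ?_
  rintro v ⟨hv, hvx, hr⟩
  refine ⟨hv, ?_, hvx⟩
  obtain ⟨h1, h2, h3, h4⟩ := hvx
  simp only [height] at *
  refine ⟨?_, ?_, ?_, ?_⟩ <;> simp only <;> linarith

lemma exists_sub_mem_tile {Γ : AddSubgroup (ℝ × ℝ × ℝ × ℝ)}
    (hf : ∀ x y, ((Γ : Set (ℝ × ℝ × ℝ × ℝ)) ∩ Icc x y).Finite)
    (hcov : ∀ x, ∃ v ∈ Γ, 0 ≤ x - v ∧ height (x - v) ≤ 1) (x : ℝ × ℝ × ℝ × ℝ) :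
    ∃ v ∈ Γ, x - v ∈ tile Γ := by
  obtain ⟨v₀, hv₀, h0, h1⟩ := hcov x
  obtain ⟨v, ⟨hv, hvx, hr⟩, hmax⟩ := Set.exists_max_image _ key (finite_below hf x (height x - 1))
    ⟨v₀, hv₀, sub_nonneg.1 h0, by rw [height_sub] at h1; linarith⟩
  refine ⟨v, hv, sub_nonneg.2 hvx, fun w hw hpos hle => ?_⟩
  have hw0 := height_nonneg_of_key_pos hpos
  have := hmax (w + v) ⟨Γ.add_mem hw hv, by rwa [le_sub_iff_add_le] at hle,
    by rw [height_add]; linarith⟩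
  rw [map_add] at this
  exact absurd hpos (not_lt.2 (by simpa using this))

lemma height_le_one_of_mem_tile {Γ : AddSubgroup (ℝ × ℝ × ℝ × ℝ)}
    (hcov : ∀ x, ∃ v ∈ Γ, 0 ≤ x - v ∧ height (x - v) ≤ 1) {x : ℝ × ℝ × ℝ × ℝ}
    (hx : x ∈ tile Γ) : height x ≤ 1 := by
  by_contra! h
  obtain ⟨v, hv, h0, h1⟩ := hcov x
  rw [height_sub] at h1
  exact hx.2 v hv (key_pos_of_height_pos (by linarith)) (sub_nonneg.1 h0)

lemma mem_tile_of_le {Γ : AddSubgroup (ℝ × ℝ × ℝ × ℝ)} {x y : ℝ × ℝ × ℝ × ℝ} (hx : x ∈ tile Γ)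
    (hy : 0 ≤ y) (hyx : y ≤ x) : y ∈ tile Γ :=
  ⟨hy, fun v hv hpos hle => hx.2 v hv hpos (hle.trans hyx)⟩

lemma measurableSet_tile {Γ : AddSubgroup (ℝ × ℝ × ℝ × ℝ)} (hc : (Γ : Set (ℝ × ℝ × ℝ × ℝ)).Countable) :
    MeasurableSet (tile Γ) := by
  have : tile Γ = Ici 0 ∩ ⋂ v ∈ (Γ : Set (ℝ × ℝ × ℝ × ℝ)), {x | 0 < key v → ¬ v ≤ x} := by
    ext x; simp [tile]
  rw [this]
  refine measurableSet_Ici.inter (MeasurableSet.biInter hc fun v _ => ?_)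
  by_cases h : 0 < key v
  · convert (measurableSet_Ici (a := v)).compl using 1
    ext x
    simp [h]
  · simp [h]

/-! ### Inner corners of the planar slices -/

/-- For a lattice vector `v`, the parameters `c` such that the planar slice of the tile over `c` has
an inner corner at the first two coordinates of `v`, and such that, moreover, the translate of the
tile by `v` has its apex there. -/
def cornerSet (Γ : AddSubgroup (ℝ × ℝ × ℝ × ℝ)) (v : ℝ × ℝ × ℝ × ℝ) : Set (ℝ × ℝ) :=
  {c | 0 ≤ c ∧ (0, 0, c - v.2.2) ∈ tile Γ ∧ ∀ w ∈ Γ, 0 < key w → w.2.2 ≤ c →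
    ¬ (w.2.1 < v.2.1 ∧ w.1 ≤ v.1) ∧ ¬ (w.2.1 ≤ v.2.1 ∧ w.1 < v.1)}

lemma measurableSet_cornerSet {Γ : AddSubgroup (ℝ × ℝ × ℝ × ℝ)} (hc : (Γ : Set (ℝ × ℝ × ℝ × ℝ)).Countable)
    (v : ℝ × ℝ × ℝ × ℝ) : MeasurableSet (cornerSet Γ v) := by
  have : cornerSet Γ v = Ici 0 ∩ ((fun c : ℝ × ℝ => ((0 : ℝ), (0 : ℝ), c - v.2.2)) ⁻¹' tile Γ ∩
      ⋂ w ∈ (Γ : Set (ℝ × ℝ × ℝ × ℝ)), {c | 0 < key w → w.2.2 ≤ c →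
        ¬ (w.2.1 < v.2.1 ∧ w.1 ≤ v.1) ∧ ¬ (w.2.1 ≤ v.2.1 ∧ w.1 < v.1)}) := by
    ext x; simp [cornerSet]
  rw [this]
  refine measurableSet_Ici.inter (MeasurableSet.inter ?_ (MeasurableSet.biInter hc fun w _ => ?_))
  · exact measurableSet_preimage (by fun_prop) (measurableSet_tile hc)
  · by_cases h : 0 < key w ∧ ¬ (¬ (w.2.1 < v.2.1 ∧ w.1 ≤ v.1) ∧ ¬ (w.2.1 ≤ v.2.1 ∧ w.1 < v.1))
    · convert (measurableSet_Ici (a := w.2.2)).compl using 1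
      ext c
      simp only [mem_ofPred_eq, mem_compl_iff, mem_Ici]
      tauto
    · convert MeasurableSet.univ using 1
      ext c
      simp only [mem_ofPred_eq, mem_univ, iff_true]
      tauto

/-- Two lattice vectors with positive first coordinates cannot have corners over parameters that
become equal after translation: their difference, taken with the sign that makes it positive, would
cut off one of the two corners. -/
lemma not_mem_cornerSet_of_key_lt {Γ : AddSubgroup (ℝ × ℝ × ℝ × ℝ)} {v v' : ℝ × ℝ × ℝ × ℝ}
    (hv : v ∈ Γ) (hv' : v' ∈ Γ) (h1 : 0 < v.1) (h2 : 0 < v.2.1) (hlt : key v < key v') {c : ℝ × ℝ}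
    (hc : c + v.2.2 ∈ cornerSet Γ v) : c + v'.2.2 ∉ cornerSet Γ v' := by
  intro hc'
  have hpos : 0 < key (v' - v) := by rw [map_sub]; exact sub_pos.2 hlt
  have hle : (v' - v).2.2 ≤ c + v'.2.2 := by
    have h0 := hc.1
    rw [Prod.snd_sub, Prod.snd_sub]
    calc v'.2.2 - v.2.2 ≤ v'.2.2 - v.2.2 + (c + v.2.2) := le_add_of_nonneg_right h0
      _ = c + v'.2.2 := by abel
  refine (hc'.2.2 _ (Γ.sub_mem hv' hv) hpos hle).1 ⟨?_, ?_⟩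
  · simp only [Prod.snd_sub, Prod.fst_sub]; linarith
  · simp only [Prod.fst_sub]; linarith

/-- On average, a planar slice of the tile has at most one inner corner. -/
lemma tsum_volume_cornerSet_le {Γ : AddSubgroup (ℝ × ℝ × ℝ × ℝ)} (hc : (Γ : Set (ℝ × ℝ × ℝ × ℝ)).Countable) :
    ∑' v : {v | v ∈ Γ ∧ 0 < v.1 ∧ 0 < v.2.1}, volume (cornerSet Γ v) ≤
      volume {c : ℝ × ℝ | ((0 : ℝ), (0 : ℝ), c) ∈ tile Γ} := by
  have : Countable {v | v ∈ Γ ∧ 0 < v.1 ∧ 0 < v.2.1} :=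
    (hc.mono fun v hv => hv.1 : Set.Countable {v | v ∈ Γ ∧ 0 < v.1 ∧ 0 < v.2.1}).to_subtype
  calc ∑' v : {v | v ∈ Γ ∧ 0 < v.1 ∧ 0 < v.2.1}, volume (cornerSet Γ v)
      = ∑' v : {v | v ∈ Γ ∧ 0 < v.1 ∧ 0 < v.2.1},
          volume ((fun c => c + v.1.2.2) ⁻¹' cornerSet Γ v) := by
        simp only [measure_preimage_add_right]
    _ = volume (⋃ v : {v | v ∈ Γ ∧ 0 < v.1 ∧ 0 < v.2.1},
          (fun c => c + v.1.2.2) ⁻¹' cornerSet Γ v) := by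
        refine (measure_iUnion ?_ fun v => ?_).symm
        · intro v v' hne
          refine Set.disjoint_left.2 fun c hcv hcv' => ?_
          rcases lt_trichotomy (key v) (key v') with h | h | h
          · exact not_mem_cornerSet_of_key_lt v.2.1 v'.2.1 v.2.2.1 v.2.2.2 h hcv hcv'
          · exact hne (Subtype.ext (key_injective h))
          · exact not_mem_cornerSet_of_key_lt v'.2.1 v.2.1 v'.2.2.1 v'.2.2.2 h hcv' hcv
        · exact measurableSet_preimage (by fun_prop) (measurableSet_cornerSet hc v)
    _ ≤ _ := by
        refine measure_mono (iUnion_subset fun v c hcv => ?_)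
        simpa using hcv.2.1

/-- A point `(b, a, c)` of the tile at height `1 - δ` is within `δ` of the end of its row. If the
slice over `c` extends beyond `a + δ` on the axis, then this end lies above an inner corner. -/
lemma exists_corner {Γ : AddSubgroup (ℝ × ℝ × ℝ × ℝ)}
    (hf : ∀ x y, ((Γ : Set (ℝ × ℝ × ℝ × ℝ)) ∩ Icc x y).Finite)
    (hcov : ∀ x, ∃ v ∈ Γ, 0 ≤ x - v ∧ height (x - v) ≤ 1) {b a δ : ℝ} {c : ℝ × ℝ}
    (hδ : 0 ≤ δ) (hx : (b, a, c) ∈ tile Γ) (hh : height (b, a, c) = 1 - δ)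
    (hend : ((0 : ℝ), a + δ, c) ∈ tile Γ) :
    ∃ v ∈ Γ, 0 < v.1 ∧ 0 < v.2.1 ∧ a ∈ Icc (v.2.1 - δ) v.2.1 ∧ c ∈ cornerSet Γ v := by
  obtain ⟨hb, ha, hc⟩ : 0 ≤ b ∧ 0 ≤ a ∧ 0 ≤ c := hx.1
  -- every point of the row beyond `a + δ` has height above `1`, so it lies outside the tile
  have hout : ∀ t, δ < t → ∃ v ∈ Γ, 0 < key v ∧ v ≤ (b, a + t, c) := by
    intro t ht
    by_contra! h
    have := height_le_one_of_mem_tile hcov (x := (b, a + t, c))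
      ⟨⟨hb, by simp only [Prod.fst_zero, Prod.snd_zero]; linarith, hc⟩, h⟩
    simp only [height] at this hh
    linarith
  have hfin : {v | v ∈ Γ ∧ 0 < key v ∧ v ≤ (b, a + (δ + 1), c)}.Finite :=
    (finite_below hf (b, a + (δ + 1), c) 0).subset
      fun v hv => ⟨hv.1, hv.2.2, height_nonneg_of_key_pos hv.2.1⟩
  -- the corner is found by minimizing the second coordinate, then the first, and maximizing the key
  obtain ⟨v₁, hv₁, hmin₁⟩ := Set.exists_min_image _ (fun v => v.2.1) hfin
    (by obtain ⟨v, h1, h2, h3⟩ := hout (δ + 1) (by linarith); exact ⟨v, h1, h2, h3⟩)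
  obtain ⟨v₂, hv₂, hmin₂⟩ := Set.exists_min_image _ (fun v => v.1)
    (hfin.subset (inter_subset_left (t := {v | v.2.1 = v₁.2.1})))
    ⟨v₁, mem_inter hv₁ (mem_ofPred.2 rfl)⟩
  obtain ⟨v, ⟨⟨⟨hv, hpos, hle⟩, e₁⟩, e₂⟩, hmax⟩ := Set.exists_max_image _ key
    ((hfin.subset (inter_subset_left (t := {v | v.2.1 = v₁.2.1}))).subset
      (inter_subset_left (t := {v | v.1 = v₂.1}))) ⟨v₂, mem_inter hv₂ (mem_ofPred.2 rfl)⟩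
  simp only [mem_ofPred_eq] at e₁ e₂
  rw [← e₁] at hmin₁
  rw [← e₂] at hmin₂
  obtain ⟨hle1, hle2, hle3⟩ : v.1 ≤ b ∧ v.2.1 ≤ a + (δ + 1) ∧ v.2.2 ≤ c := hle
  have hva : a < v.2.1 := by
    by_contra! h
    exact hx.2 v hv hpos ⟨hle1, h, hle3⟩
  have hvδ : v.2.1 ≤ a + δ := by
    refine le_of_forall_gt_imp_ge_of_dense fun y hy => ?_
    rcases le_total y (a + (δ + 1)) with hy1 | hy1
    · obtain ⟨w, hw, hwpos, hw1, hw2, hw3⟩ := hout (y - a) (by linarith)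
      simp only [add_sub_cancel] at hw1 hw2 hw3
      exact (hmin₁ w ⟨hw, hwpos, hw1, hw2.trans hy1, hw3⟩).trans hw2
    · exact hle2.trans hy1
  have hvb : 0 < v.1 := by
    by_contra! h
    exact hend.2 v hv hpos ⟨h, hvδ, hle3⟩
  refine ⟨v, hv, hvb, by linarith, ⟨by linarith, hva.le⟩, hc, ⟨⟨le_rfl, le_rfl, sub_nonneg.2 hle3⟩,
    fun w hw hwpos hwle => ?_⟩, fun w hw hwpos hwle => ⟨fun h => ?_, fun h => ?_⟩⟩
  · -- adding `w` to `v` would give a vector with the same corner and a larger key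
    obtain ⟨hw1, hw2, hw3⟩ : w.1 ≤ 0 ∧ w.2.1 ≤ 0 ∧ w.2.2 ≤ c - v.2.2 := hwle
    have hmem : w + v ∈ {v | v ∈ Γ ∧ 0 < key v ∧ v ≤ (b, a + (δ + 1), c)} :=
      ⟨Γ.add_mem hw hv, by rw [map_add]; exact add_pos hwpos hpos,
        by simp only [Prod.fst_add]; linarith,
        by simp only [Prod.fst_add, Prod.snd_add]; linarith,
        by rw [Prod.snd_add, Prod.snd_add]; exact le_sub_iff_add_le.1 hw3⟩
    have g1 := hmin₁ _ hmem
    simp only [Prod.snd_add, Prod.fst_add] at g1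
    have hmem₁ : (w + v).2.1 = v₁.2.1 := by
      simp only [Prod.snd_add, Prod.fst_add]; linarith
    have g2 := hmin₂ _ ⟨hmem, hmem₁⟩
    simp only [Prod.fst_add] at g2
    have g3 := hmax (w + v) ⟨⟨hmem, hmem₁⟩, by simp only [mem_ofPred_eq, Prod.fst_add]; linarith⟩
    rw [map_add] at g3
    exact absurd hwpos (not_lt.2 (by simpa using g3))
  · exact absurd (hmin₁ w ⟨hw, hwpos, h.2.trans hle1, h.1.le.trans hle2, hwle⟩) (not_le.2 h.1)
  · have hmem : w ∈ {v | v ∈ Γ ∧ 0 < key v ∧ v ≤ (b, a + (δ + 1), c)} :=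
      ⟨hw, hwpos, h.2.le.trans hle1, h.1.trans hle2, hwle⟩
    have g1 := hmin₁ w hmem
    exact absurd (hmin₂ w ⟨hmem, by simp only [mem_ofPred_eq]; linarith⟩) (not_le.2 h.2)

/-! ### Volumes of simplices -/

lemma setLIntegral_Icc_ofReal {f : ℝ → ℝ} (hf : Continuous f) {a b : ℝ} (hab : a ≤ b)
    (h0 : ∀ x ∈ Icc a b, 0 ≤ f x) :
    ∫⁻ x in Icc a b, ENNReal.ofReal (f x) = ENNReal.ofReal (∫ x in a..b, f x) := by
  rw [intervalIntegral.integral_of_le hab, ← integral_Icc_eq_integral_Ioc,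
    ofReal_integral_eq_lintegral_ofReal hf.continuousOn.integrableOn_Icc]
  exact (ae_restrict_iff' measurableSet_Icc).2 (Filter.Eventually.of_forall h0)

/-- The volume of a cone over a family of sets whose volume grows like a power. -/
lemma volume_cone {Z : Type*} [MeasureSpace Z] [SFinite (volume : Measure Z)] {A : ℝ → Set Z}
    {K : ℝ} (hK : 0 ≤ K) (n : ℕ) (hA : ∀ r, 0 ≤ r → volume (A r) = ENNReal.ofReal (K * r ^ n))
    {r : ℝ} (hr : 0 ≤ r)
    (hm : MeasurableSet {z : ℝ × Z | 0 ≤ z.1 ∧ z.1 ≤ r ∧ z.2 ∈ A (r - z.1)}) :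
    volume {z : ℝ × Z | 0 ≤ z.1 ∧ z.1 ≤ r ∧ z.2 ∈ A (r - z.1)} =
      ENNReal.ofReal (K / (n + 1) * r ^ (n + 1)) := by
  have h : ∀ x : ℝ, volume (Prod.mk x ⁻¹' {z : ℝ × Z | 0 ≤ z.1 ∧ z.1 ≤ r ∧ z.2 ∈ A (r - z.1)}) =
      (Icc 0 r).indicator (fun x => ENNReal.ofReal (K * (r - x) ^ n)) x := by
    intro x
    by_cases hx : x ∈ Icc 0 r
    · rw [indicator_of_mem hx, ← hA _ (sub_nonneg.2 hx.2)]
      congr 1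
      ext z
      simp [hx.1, hx.2]
    · rw [indicator_of_notMem hx, ← measure_empty (μ := (volume : Measure Z))]
      congr 1
      ext z
      simp only [mem_preimage, mem_ofPred_eq, mem_empty_iff_false, iff_false]
      exact fun h => hx ⟨h.1, h.2.1⟩
  rw [Measure.volume_eq_prod, Measure.prod_apply hm, lintegral_congr h,
    lintegral_indicator measurableSet_Icc, setLIntegral_Icc_ofReal (by fun_prop) hr
      (fun x hx => mul_nonneg hK (pow_nonneg (sub_nonneg.2 hx.2) n))]
  congr 1
  rw [intervalIntegral.integral_const_mul,
    intervalIntegral.integral_comp_sub_left (fun x => x ^ n), integral_pow]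
  simp
  ring

lemma volume_simplex_two {r : ℝ} (hr : 0 ≤ r) :
    volume {c : ℝ × ℝ | 0 ≤ c ∧ c.1 + c.2 ≤ r} = ENNReal.ofReal (1 / 2 * r ^ 2) := by
  have e : {c : ℝ × ℝ | 0 ≤ c ∧ c.1 + c.2 ≤ r} =
      {z : ℝ × ℝ | 0 ≤ z.1 ∧ z.1 ≤ r ∧ z.2 ∈ Icc 0 (r - z.1)} := by
    ext ⟨x, y⟩
    simp only [mem_ofPred_eq, mem_Icc, Prod.le_def, Prod.fst_zero, Prod.snd_zero]
    constructor
    · rintro ⟨⟨h1, h2⟩, h3⟩; refine ⟨h1, ?_, h2, ?_⟩ <;> linarith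
    · rintro ⟨h1, h2, h3, h4⟩; exact ⟨⟨h1, h3⟩, by linarith⟩
  have hm : MeasurableSet {c : ℝ × ℝ | 0 ≤ c ∧ c.1 + c.2 ≤ r} :=
    measurableSet_Ici.inter (measurableSet_le (f := fun c : ℝ × ℝ => c.1 + c.2)
      (by fun_prop) measurable_const)
  rw [e] at hm ⊢
  rw [volume_cone (A := fun r => Icc 0 r) zero_le_one 1 (fun r hr => by simp) hr hm]
  norm_num

lemma volume_simplex_three {r : ℝ} (hr : 0 ≤ r) :
    volume {z : ℝ × ℝ × ℝ | 0 ≤ z ∧ z.1 + z.2.1 + z.2.2 ≤ r} =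
      ENNReal.ofReal (1 / 6 * r ^ 3) := by
  have e : {z : ℝ × ℝ × ℝ | 0 ≤ z ∧ z.1 + z.2.1 + z.2.2 ≤ r} =
      {z : ℝ × ℝ × ℝ | 0 ≤ z.1 ∧ z.1 ≤ r ∧
        z.2 ∈ {c : ℝ × ℝ | 0 ≤ c ∧ c.1 + c.2 ≤ r - z.1}} := by
    ext ⟨x, y, z⟩
    simp only [mem_ofPred_eq, Prod.le_def, Prod.fst_zero, Prod.snd_zero]
    constructor
    · rintro ⟨⟨h1, h2, h3⟩, h4⟩; refine ⟨h1, ?_, ⟨h2, h3⟩, ?_⟩ <;> linarith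
    · rintro ⟨h1, h2, ⟨h3, h4⟩, h5⟩; exact ⟨⟨h1, h3, h4⟩, by linarith⟩
  have hm : MeasurableSet {z : ℝ × ℝ × ℝ | 0 ≤ z ∧ z.1 + z.2.1 + z.2.2 ≤ r} :=
    measurableSet_Ici.inter (measurableSet_le (f := fun z : ℝ × ℝ × ℝ => z.1 + z.2.1 + z.2.2)
      (by fun_prop) measurable_const)
  rw [e] at hm ⊢
  rw [volume_cone (A := fun r => {c : ℝ × ℝ | 0 ≤ c ∧ c.1 + c.2 ≤ r}) (K := 1 / 2) (by norm_num) 2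
    (fun r hr => volume_simplex_two hr) hr hm]
  norm_num

lemma volume_simplex_four :
    volume {x : ℝ × ℝ × ℝ × ℝ | 0 ≤ x ∧ height x ≤ 1} = ENNReal.ofReal (1 / 24) := by
  have e : {x : ℝ × ℝ × ℝ × ℝ | 0 ≤ x ∧ height x ≤ 1} =
      {x : ℝ × ℝ × ℝ × ℝ | 0 ≤ x.1 ∧ x.1 ≤ 1 ∧
        x.2 ∈ {z : ℝ × ℝ × ℝ | 0 ≤ z ∧ z.1 + z.2.1 + z.2.2 ≤ 1 - x.1}} := by
    ext ⟨w, x, y, z⟩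
    simp only [height, mem_ofPred_eq, Prod.le_def, Prod.fst_zero, Prod.snd_zero]
    constructor
    · rintro ⟨⟨h1, h2, h3, h4⟩, h5⟩; refine ⟨h1, ?_, ⟨h2, h3, h4⟩, ?_⟩ <;> linarith
    · rintro ⟨h1, h2, ⟨h3, h4, h5⟩, h6⟩; exact ⟨⟨h1, h3, h4, h5⟩, by linarith⟩
  have hm : MeasurableSet {x : ℝ × ℝ × ℝ × ℝ | 0 ≤ x ∧ height x ≤ 1} :=
    measurableSet_Ici.inter (measurableSet_le (f := height) (by unfold height; fun_prop)
      measurable_const)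
  rw [e] at hm ⊢
  rw [volume_cone (A := fun r => {z : ℝ × ℝ × ℝ | 0 ≤ z ∧ z.1 + z.2.1 + z.2.2 ≤ r}) (K := 1 / 6)
    (by norm_num) 3 (fun r hr => volume_simplex_three hr) zero_le_one hm]
  norm_num

/-! ### The volume of the tile -/

/-- The points of the tile at height `1 - δ`, projected along the first coordinate. -/
def tileSection (Γ : AddSubgroup (ℝ × ℝ × ℝ × ℝ)) (δ : ℝ) : Set (ℝ × ℝ × ℝ) :=
  {z | (1 - δ - (z.1 + z.2.1 + z.2.2), z) ∈ tile Γ}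

lemma height_of_section (δ : ℝ) (z : ℝ × ℝ × ℝ) :
    height (1 - δ - (z.1 + z.2.1 + z.2.2), z) = 1 - δ := by
  simp only [height]; ring

lemma volume_tile_eq {Γ : AddSubgroup (ℝ × ℝ × ℝ × ℝ)}
    (hc : (Γ : Set (ℝ × ℝ × ℝ × ℝ)).Countable) :
    volume (tile Γ) = ∫⁻ δ : ℝ, volume (tileSection Γ δ) := by
  have hT := measurableSet_tile hc
  have hm : MeasurableSet {p : ℝ × ℝ × ℝ × ℝ | p.2 ∈ tileSection Γ p.1} :=
    measurableSet_preimage (f := fun p : ℝ × ℝ × ℝ × ℝ =>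
      (1 - p.1 - (p.2.1 + p.2.2.1 + p.2.2.2), p.2)) (by fun_prop) hT
  rw [Measure.volume_eq_prod, Measure.prod_apply_symm hT]
  trans (volume : Measure ℝ).prod volume {p : ℝ × ℝ × ℝ × ℝ | p.2 ∈ tileSection Γ p.1}
  · rw [Measure.prod_apply_symm hm]
    refine lintegral_congr fun z => ?_
    rw [← (Measure.measurePreserving_sub_left volume (1 - (z.1 + z.2.1 + z.2.2))).measure_preimage
      (measurableSet_preimage (by fun_prop) hT).nullMeasurableSet]
    congr 1
    ext δ
    simp only [mem_preimage, mem_ofPred_eq, tileSection]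
    rw [show 1 - (z.1 + z.2.1 + z.2.2) - δ = 1 - δ - (z.1 + z.2.1 + z.2.2) by ring]
  · rw [Measure.prod_apply hm]
    rfl

lemma tileSection_eq_empty {Γ : AddSubgroup (ℝ × ℝ × ℝ × ℝ)}
    (hcov : ∀ x, ∃ v ∈ Γ, 0 ≤ x - v ∧ height (x - v) ≤ 1) {δ : ℝ} (hδ : δ ∉ Icc (0 : ℝ) 1) :
    tileSection Γ δ = ∅ := by
  refine eq_empty_of_forall_notMem fun z hz => hδ ?_
  have h1 := height_le_one_of_mem_tile hcov hz
  obtain ⟨h2, h3, h4, h5⟩ : 0 ≤ 1 - δ - (z.1 + z.2.1 + z.2.2) ∧ 0 ≤ z.1 ∧ 0 ≤ z.2.1 ∧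
    0 ≤ z.2.2 := hz.1
  rw [height_of_section] at h1
  constructor <;> linarith

lemma tileSection_subset (Γ : AddSubgroup (ℝ × ℝ × ℝ × ℝ)) (δ : ℝ) :
    tileSection Γ δ ⊆ {z | 0 ≤ z ∧ z.1 + z.2.1 + z.2.2 ≤ 1 - δ} := by
  intro z hz
  obtain ⟨h1, h2⟩ : 0 ≤ 1 - δ - (z.1 + z.2.1 + z.2.2) ∧ 0 ≤ z := hz.1
  exact ⟨h2, by linarith⟩

/-- The rows on the coordinate hyperplane `b = 0` lose only a segment of length `δ` when shifted
by `δ`. -/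
lemma volume_axis_end_le {Γ : AddSubgroup (ℝ × ℝ × ℝ × ℝ)}
    (hc : (Γ : Set (ℝ × ℝ × ℝ × ℝ)).Countable)
    (hcov : ∀ x, ∃ v ∈ Γ, 0 ≤ x - v ∧ height (x - v) ≤ 1) {δ : ℝ} (h0 : 0 ≤ δ) (h1 : δ ≤ 1) :
    volume {z : ℝ × ℝ × ℝ | (0 ≤ z.2 ∧ z.2.1 + z.2.2 ≤ 1 - δ) ∧ ((0 : ℝ), z) ∈ tile Γ ∧
      ((0 : ℝ), z.1 + δ, z.2) ∉ tile Γ} ≤ ENNReal.ofReal (δ * (1 / 2 * (1 - δ) ^ 2)) := by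
  have hT := measurableSet_tile hc
  have hS : MeasurableSet {c : ℝ × ℝ | 0 ≤ c ∧ c.1 + c.2 ≤ 1 - δ} :=
    measurableSet_Ici.inter (measurableSet_le (f := fun c : ℝ × ℝ => c.1 + c.2)
      (by fun_prop) measurable_const)
  have hm : MeasurableSet {z : ℝ × ℝ × ℝ | (0 ≤ z.2 ∧ z.2.1 + z.2.2 ≤ 1 - δ) ∧
      ((0 : ℝ), z) ∈ tile Γ ∧ ((0 : ℝ), z.1 + δ, z.2) ∉ tile Γ} :=
    (measurableSet_preimage (f := fun z : ℝ × ℝ × ℝ => z.2) (by fun_prop) hS).inter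
      ((measurableSet_preimage (f := fun z : ℝ × ℝ × ℝ => ((0 : ℝ), z)) (by fun_prop) hT).inter
        (measurableSet_preimage (f := fun z : ℝ × ℝ × ℝ => ((0 : ℝ), z.1 + δ, z.2))
          (by fun_prop) hT).compl)
  rw [Measure.volume_eq_prod, Measure.prod_apply_symm hm]
  calc _ ≤ ∫⁻ c : ℝ × ℝ, {c : ℝ × ℝ | 0 ≤ c ∧ c.1 + c.2 ≤ 1 - δ}.indicator
          (fun _ => ENNReal.ofReal δ) c := by
        refine lintegral_mono fun c => ?_
        by_cases hcS : c ∈ {c : ℝ × ℝ | 0 ≤ c ∧ c.1 + c.2 ≤ 1 - δ}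
        · rw [indicator_of_mem hcS]
          -- the row over `c` is an interval that starts at `0`
          set R : Set ℝ := {a | ((0 : ℝ), a, c) ∈ tile Γ}
          have hbdd : BddAbove R := by
            refine ⟨1, fun a ha => ?_⟩
            have h2 := height_le_one_of_mem_tile hcov ha
            obtain ⟨-, -, h3, h4⟩ := ha.1
            simp only [height, Prod.fst_zero, Prod.snd_zero] at h2 h3 h4
            linarith
          calc _ ≤ volume (Icc (sSup R - δ) (sSup R)) := by
                refine measure_mono fun a ha => ?_
                obtain ⟨-, ha1, ha2⟩ := ha
                refine ⟨?_, le_csSup hbdd ha1⟩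
                rw [sub_le_iff_le_add]
                refine csSup_le ⟨a, ha1⟩ fun y hy => ?_
                by_contra! hlt
                obtain ⟨-, hp, hq⟩ := ha1.1
                simp only [Prod.fst_zero, Prod.snd_zero] at hp hq
                exact ha2 (mem_tile_of_le hy ⟨le_rfl, by
                  simp only [Prod.fst_zero, Prod.snd_zero]; linarith, hq⟩ ⟨le_rfl, hlt.le, le_rfl⟩)
            _ = ENNReal.ofReal δ := by rw [Real.volume_Icc]; congr 1; ring
        · rw [indicator_of_notMem hcS, nonpos_iff_eq_zero,
            ← measure_empty (μ := (volume : Measure ℝ))]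
          congr 1
          exact eq_empty_of_forall_notMem fun a ha => hcS ha.1
    _ = _ := by
        rw [lintegral_indicator hS, lintegral_const, Measure.restrict_apply_univ,
          volume_simplex_two (by linarith), ← ENNReal.ofReal_mul h0]

/-- Along a section just below the top, every row ends within `δ`: at inner corners, of which the
slices have at most one on average, or on the hyperplane `b = 0`. -/
lemma volume_tileSection_le {Γ : AddSubgroup (ℝ × ℝ × ℝ × ℝ)}
    (hc : (Γ : Set (ℝ × ℝ × ℝ × ℝ)).Countable)
    (hf : ∀ x y, ((Γ : Set (ℝ × ℝ × ℝ × ℝ)) ∩ Icc x y).Finite)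
    (hcov : ∀ x, ∃ v ∈ Γ, 0 ≤ x - v ∧ height (x - v) ≤ 1) {δ : ℝ} (h0 : 0 ≤ δ) (h1 : δ ≤ 1) :
    volume (tileSection Γ δ) ≤ ENNReal.ofReal (δ * (1 / 2 * (1 - δ) ^ 2) + δ * (1 / 2)) := by
  have : Countable {v | v ∈ Γ ∧ 0 < v.1 ∧ 0 < v.2.1} :=
    (hc.mono fun v hv => hv.1 : Set.Countable {v | v ∈ Γ ∧ 0 < v.1 ∧ 0 < v.2.1}).to_subtype
  have hsub : tileSection Γ δ ⊆ {z : ℝ × ℝ × ℝ | (0 ≤ z.2 ∧ z.2.1 + z.2.2 ≤ 1 - δ) ∧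
      ((0 : ℝ), z) ∈ tile Γ ∧ ((0 : ℝ), z.1 + δ, z.2) ∉ tile Γ} ∪
      ⋃ v : {v | v ∈ Γ ∧ 0 < v.1 ∧ 0 < v.2.1},
        Icc (v.1.2.1 - δ) v.1.2.1 ×ˢ cornerSet Γ v := by
    rintro ⟨a, c⟩ hz
    obtain ⟨hb, ha, hc0⟩ : 0 ≤ 1 - δ - (a + c.1 + c.2) ∧ 0 ≤ a ∧ 0 ≤ c := hz.1
    by_cases hend : ((0 : ℝ), a + δ, c) ∈ tile Γ
    · obtain ⟨v, hv, hv1, hv2, hav, hcv⟩ :=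
        exists_corner hf hcov h0 hz (height_of_section δ (a, c)) hend
      exact Or.inr (mem_iUnion.2 ⟨⟨v, hv, hv1, hv2⟩, hav, hcv⟩)
    · exact Or.inl ⟨⟨hc0, by simp only; linarith⟩,
        mem_tile_of_le hz ⟨le_rfl, ha, hc0⟩ ⟨hb, le_rfl, le_rfl⟩, hend⟩
  have hbase : volume {c : ℝ × ℝ | ((0 : ℝ), (0 : ℝ), c) ∈ tile Γ} ≤ ENNReal.ofReal (1 / 2) := by
    refine (measure_mono fun c hcT => ?_).trans_eq
      ((volume_simplex_two zero_le_one).trans (by norm_num))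
    have h := height_le_one_of_mem_tile hcov hcT
    simp only [height] at h
    exact ⟨hcT.1.2.2, by linarith⟩
  rw [ENNReal.ofReal_add (by positivity) (by positivity)]
  refine (measure_mono hsub).trans ((measure_union_le _ _).trans
    (add_le_add (volume_axis_end_le hc hcov h0 h1) ?_))
  calc _ ≤ ∑' v : {v | v ∈ Γ ∧ 0 < v.1 ∧ 0 < v.2.1},
          volume (Icc (v.1.2.1 - δ) v.1.2.1 ×ˢ cornerSet Γ v) := measure_iUnion_le _
    _ = ENNReal.ofReal δ * ∑' v : {v | v ∈ Γ ∧ 0 < v.1 ∧ 0 < v.2.1}, volume (cornerSet Γ v) := by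
        rw [← ENNReal.tsum_mul_left]
        refine tsum_congr fun v => ?_
        rw [Measure.volume_eq_prod, Measure.prod_prod, Real.volume_Icc]
        congr 2
        ring
    _ ≤ ENNReal.ofReal δ * ENNReal.ofReal (1 / 2) := by
        gcongr
        exact (tsum_volume_cornerSet_le hc).trans hbase
    _ = _ := (ENNReal.ofReal_mul h0).symm

lemma volume_tile_le {Γ : AddSubgroup (ℝ × ℝ × ℝ × ℝ)}
    (hc : (Γ : Set (ℝ × ℝ × ℝ × ℝ)).Countable)
    (hf : ∀ x y, ((Γ : Set (ℝ × ℝ × ℝ × ℝ)) ∩ Icc x y).Finite)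
    (hcov : ∀ x, ∃ v ∈ Γ, 0 ≤ x - v ∧ height (x - v) ≤ 1) :
    volume (tile Γ) ≤ ENNReal.ofReal (11 / 343) := by
  have hsupp : ∫⁻ δ : ℝ, volume (tileSection Γ δ) =
      ∫⁻ δ in Icc (0 : ℝ) 1, volume (tileSection Γ δ) := by
    rw [← lintegral_indicator measurableSet_Icc]
    refine lintegral_congr fun δ => ?_
    by_cases hδ : δ ∈ Icc (0 : ℝ) 1
    · rw [indicator_of_mem hδ]
    · rw [indicator_of_notMem hδ, tileSection_eq_empty hcov hδ, measure_empty]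
  -- `1 / 7` is close to the point where the two bounds for the sections cross
  calc volume (tile Γ) = ∫⁻ δ in Icc (0 : ℝ) 1, volume (tileSection Γ δ) := by
        rw [volume_tile_eq hc, hsupp]
    _ ≤ (∫⁻ δ in Icc (0 : ℝ) (1 / 7), volume (tileSection Γ δ)) +
          ∫⁻ δ in Icc (1 / 7 : ℝ) 1, volume (tileSection Γ δ) := by
        rw [← Icc_union_Icc_eq_Icc (show (0 : ℝ) ≤ 1 / 7 by norm_num)
          (show (1 / 7 : ℝ) ≤ 1 by norm_num)]
        exact lintegral_union_le _ _ _
    _ ≤ (∫⁻ δ in Icc (0 : ℝ) (1 / 7),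
            ENNReal.ofReal (δ * (1 / 2 * (1 - δ) ^ 2) + δ * (1 / 2))) +
          ∫⁻ δ in Icc (1 / 7 : ℝ) 1, ENNReal.ofReal (1 / 6 * (1 - δ) ^ 3) := by
        refine add_le_add (setLIntegral_mono' measurableSet_Icc fun δ hδ => ?_)
          (setLIntegral_mono' measurableSet_Icc fun δ hδ => ?_)
        · exact volume_tileSection_le hc hf hcov hδ.1 (hδ.2.trans (by norm_num))
        · exact (measure_mono (tileSection_subset Γ δ)).trans_eq
            (volume_simplex_three (by linarith [hδ.2]))
    _ = ENNReal.ofReal (535 / 57624) + ENNReal.ofReal (54 / 2401) := by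
        rw [setLIntegral_Icc_ofReal (by fun_prop) (by norm_num),
          setLIntegral_Icc_ofReal (by fun_prop) (by norm_num)]
        · congr 2
          · have : ∀ δ : ℝ, δ * (1 / 2 * (1 - δ) ^ 2) + δ * (1 / 2) = δ - δ ^ 2 + 1 / 2 * δ ^ 3 :=
              fun δ => by ring
            simp only [this]
            rw [intervalIntegral.integral_add, intervalIntegral.integral_sub,
              intervalIntegral.integral_const_mul, integral_pow, integral_pow, integral_id]
            · norm_num
            all_goals exact Continuous.intervalIntegrable (by fun_prop) _ _
          · rw [intervalIntegral.integral_const_mul,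
              intervalIntegral.integral_comp_sub_left (fun x => x ^ 3), integral_pow]
            norm_num
        · intro δ hδ
          have : 0 ≤ 1 - δ := by linarith [hδ.2]
          positivity
        · intro δ hδ
          have := hδ.1
          positivity
    _ ≤ ENNReal.ofReal (11 / 343) := by
        rw [← ENNReal.ofReal_add (by norm_num) (by norm_num)]
        exact ENNReal.ofReal_le_ofReal (by norm_num)

/-! ### Passing to coordinates adapted to the simplex -/

/-- A simplex in coordinates with the origin at its first vertex. -/
lemma exists_basis_convexHull_eq (S : Affine.Simplex ℝ (EuclideanSpace ℝ (Fin 4)) 4) :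
    ∃ b : Module.Basis (Fin 4) ℝ (EuclideanSpace ℝ (Fin 4)),
      convexHull ℝ (range S.points) =
        {x | (∀ i, 0 ≤ b.repr (x - S.points 0) i) ∧ ∑ i, b.repr (x - S.points 0) i ≤ 1} := by
  let B : AffineBasis (Fin 5) ℝ (EuclideanSpace ℝ (Fin 4)) :=
    ⟨S.points, S.independent, by
      rw [S.independent.affineSpan_eq_top_iff_card_eq_finrank_add_one]; simp⟩
  let b := (B.basisOf 0).reindex (finSuccAboveEquiv 0).symm
  have hb : ∀ i, b i = S.points i.succ - S.points 0 := fun i => by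
    simp [b, B]; rfl
  have hrepr : ∀ x i, b.repr (x - S.points 0) i = B.coord i.succ x := by
    intro x i
    have h1 : ∑ i, B.coord i x = 1 := B.sum_coord_apply_eq_one x
    have h2 : ∑ i, B.coord i x • S.points i = x := B.linear_combination_coord_eq_self x
    rw [Fin.sum_univ_succ] at h1 h2
    have h3 : x - S.points 0 = ∑ i : Fin 4, B.coord i.succ x • b i := by
      simp only [hb, smul_sub, Finset.sum_sub_distrib, ← Finset.sum_smul]
      rw [eq_sub_of_add_eq' h1, eq_sub_of_add_eq' h2]
      module
    rw [h3, b.repr_sum_self]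
  refine ⟨b, ?_⟩
  rw [show S.points = ⇑B from rfl, B.convexHull_eq_nonneg_coord]
  ext x
  have h1 : ∑ i, B.coord i x = 1 := B.sum_coord_apply_eq_one x
  rw [Fin.sum_univ_succ] at h1
  have hrepr' : ∀ i, b.repr (x - B 0) i = B.coord i.succ x := hrepr x
  simp only [mem_ofPred_eq, hrepr', Fin.forall_fin_succ (P := fun i => 0 ≤ B.coord i x)]
  constructor
  · rintro ⟨h2, h3⟩; exact ⟨h3, by linarith⟩
  · rintro ⟨h2, h3⟩; exact ⟨by linarith, h2⟩

/-- The coordinates with respect to a basis of four vectors, as iterated pairs. -/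
noncomputable def coordEquiv {E : Type*} [NormedAddCommGroup E] [NormedSpace ℝ E]
    [FiniteDimensional ℝ E] (b : Module.Basis (Fin 4) ℝ E) : E ≃L[ℝ] ℝ × ℝ × ℝ × ℝ :=
  (b.equivFun.trans
    { toFun := fun f => (f 0, f 1, f 2, f 3)
      invFun := fun x => ![x.1, x.2.1, x.2.2.1, x.2.2.2]
      map_add' := fun _ _ => rfl
      map_smul' := fun _ _ => rfl
      left_inv := fun f => by ext i; fin_cases i <;> rfl
      right_inv := fun _ => rfl }).toContinuousLinearEquiv

lemma coordEquiv_apply {E : Type*} [NormedAddCommGroup E] [NormedSpace ℝ E]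
    [FiniteDimensional ℝ E] (b : Module.Basis (Fin 4) ℝ E) (x : E) :
    coordEquiv b x = (b.repr x 0, b.repr x 1, b.repr x 2, b.repr x 3) := rfl

lemma coordEquiv_mem_simplex_iff {E : Type*} [NormedAddCommGroup E] [NormedSpace ℝ E]
    [FiniteDimensional ℝ E] (b : Module.Basis (Fin 4) ℝ E) (x : E) :
    (0 ≤ coordEquiv b x ∧ height (coordEquiv b x) ≤ 1) ↔
      (∀ i, 0 ≤ b.repr x i) ∧ ∑ i, b.repr x i ≤ 1 := by
  simp only [coordEquiv_apply, height, Prod.le_def, Prod.fst_zero, Prod.snd_zero,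
    Fin.forall_fin_succ, Fin.sum_univ_four, IsEmpty.forall_iff, and_true, ← add_assoc]
  rfl

open scoped Pointwise in
/-- A set whose translates by a lattice cover the space has at least the volume of a fundamental
domain. -/
lemma ofReal_covolume_le_measure {E : Type*} [NormedAddCommGroup E] [NormedSpace ℝ E]
    [FiniteDimensional ℝ E] [MeasurableSpace E] [BorelSpace E] (μ : Measure E) [μ.IsAddHaarMeasure]
    (Λ : Submodule ℤ E) [DiscreteTopology Λ] [IsZLattice ℝ Λ] {T : Set E}
    (hT : ∀ x, ∃ v ∈ Λ, x - v ∈ T) : ENNReal.ofReal (ZLattice.covolume Λ μ) ≤ μ T := by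
  let c := Module.Free.chooseBasis ℤ Λ
  have hF := ZLattice.isAddFundamentalDomain c μ
  set F := ZSpan.fundamentalDomain (c.ofZLatticeBasis ℝ)
  rw [ZLattice.covolume_eq_measure_fundamentalDomain Λ μ hF, Measure.real]
  refine ENNReal.ofReal_toReal_le.trans ?_
  have hcov : F ⊆ ⋃ g : Λ, (g +ᵥ T) ∩ F := by
    intro x hx
    obtain ⟨v, hv, hvT⟩ := hT x
    refine mem_iUnion.2 ⟨⟨v, hv⟩, mem_vadd_set.2 ⟨x - v, hvT, ?_⟩, hx⟩
    change v + (x - v) = x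
    abel
  have : VAddInvariantMeasure Λ E μ := inferInstanceAs (VAddInvariantMeasure Λ.toAddSubgroup E μ)
  calc μ F ≤ μ (⋃ g : Λ, (g +ᵥ T) ∩ F) := measure_mono hcov
    _ ≤ ∑' g : Λ, μ ((g +ᵥ T) ∩ F) := measure_iUnion_le _
    _ = μ T := (hF.measure_eq_tsum T).symm

lemma le_coveringDensity (S : Affine.Simplex ℝ (EuclideanSpace ℝ (Fin 4)) 4)
    (Λ : Submodule ℤ (EuclideanSpace ℝ (Fin 4))) [DiscreteTopology Λ] [IsZLattice ℝ Λ]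
    (hΛ : IsLatticeCovering (convexHull ℝ (range S.points)) Λ) :
    (343 / 264 : ℝ) ≤ coveringDensity (convexHull ℝ (range S.points)) Λ := by
  obtain ⟨b, hb⟩ := exists_basis_convexHull_eq S
  set φ := coordEquiv b
  have hS : convexHull ℝ (range S.points) =
      (fun x => x + -S.points 0) ⁻¹' (φ ⁻¹' {y | 0 ≤ y ∧ height y ≤ 1}) := by
    rw [hb]
    ext x
    simp only [← sub_eq_add_neg]
    exact (coordEquiv_mem_simplex_iff b _).symm
  let Γ : AddSubgroup (ℝ × ℝ × ℝ × ℝ) := Λ.toAddSubgroup.map (φ : _ →+ ℝ × ℝ × ℝ × ℝ)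
  have hΓ : (Γ : Set (ℝ × ℝ × ℝ × ℝ)) = φ '' (Λ : Set (EuclideanSpace ℝ (Fin 4))) := rfl
  have hc : (Γ : Set (ℝ × ℝ × ℝ × ℝ)).Countable := by
    rw [hΓ]
    exact (countable_coe_iff.1 (inferInstanceAs (Countable Λ))).image _
  have hf : ∀ x y, ((Γ : Set (ℝ × ℝ × ℝ × ℝ)) ∩ Icc x y).Finite := by
    intro x y
    have hcpt : IsCompact (φ.symm '' Icc x y) := isCompact_Icc.image φ.symm.continuous
    have hcl : IsClosed (Λ : Set (EuclideanSpace ℝ (Fin 4))) := by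
      have : DiscreteTopology Λ.toAddSubgroup := inferInstanceAs (DiscreteTopology Λ)
      exact AddSubgroup.isClosed_of_discrete (H := Λ.toAddSubgroup)
    have := Metric.finite_isBounded_inter_isClosed
      (isDiscrete_iff_discreteTopology.2 (inferInstanceAs (DiscreteTopology Λ))) hcpt.isBounded hcl
    refine (this.image φ).subset ?_
    rw [hΓ]
    rintro _ ⟨⟨v, hv, rfl⟩, hmem⟩
    exact ⟨v, ⟨⟨φ v, hmem, φ.symm_apply_apply v⟩, hv⟩, rfl⟩
  have hcov : ∀ x, ∃ v ∈ Γ, 0 ≤ x - v ∧ height (x - v) ≤ 1 := by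
    intro x
    have hmem : φ.symm x + S.points 0 ∈ ⋃ v ∈ Λ, (fun x => x + v) '' convexHull ℝ (range S.points) :=
      by rw [show (⋃ v ∈ Λ, _) = univ from hΛ]; trivial
    obtain ⟨v, hv, y, hy, hyv⟩ := mem_iUnion₂.1 hmem
    refine ⟨φ v, ⟨v, hv, rfl⟩, ?_⟩
    rw [hS, mem_preimage, ← sub_eq_add_neg] at hy
    have : x - φ v = φ (y - S.points 0) := by
      rw [eq_sub_of_add_eq hyv, ← φ.apply_symm_apply x, ← map_sub, φ.symm_apply_apply]
      congr 1
      abel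
    rw [this]
    exact hy
  have hle : ENNReal.ofReal (ZLattice.covolume Λ volume) ≤ volume (φ ⁻¹' tile Γ) := by
    refine ofReal_covolume_le_measure volume Λ fun x => ?_
    obtain ⟨_, ⟨v, hv, rfl⟩, hvT⟩ := exists_sub_mem_tile hf hcov (φ x)
    exact ⟨v, hv, by rw [mem_preimage, map_sub]; exact hvT⟩
  -- in the coordinates `φ`, the volume is a multiple of the standard one
  have : (volume : Measure (ℝ × ℝ)).IsAddHaarMeasure :=
    Measure.prod.instIsAddHaarMeasure volume volume
  have : (volume : Measure (ℝ × ℝ × ℝ)).IsAddHaarMeasure :=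
    Measure.prod.instIsAddHaarMeasure volume volume
  have : (volume : Measure (ℝ × ℝ × ℝ × ℝ)).IsAddHaarMeasure :=
    Measure.prod.instIsAddHaarMeasure volume volume
  have : (Measure.map φ (volume : Measure (EuclideanSpace ℝ (Fin 4)))).IsAddHaarMeasure :=
    φ.isAddHaarMeasure_map volume
  set k := (Measure.map φ volume).addHaarScalarFactor
    (volume : Measure (ℝ × ℝ × ℝ × ℝ))
  have hscale : ∀ A : Set (ℝ × ℝ × ℝ × ℝ), volume (φ ⁻¹' A) = k * volume A := by
    intro A
    have h : Measure.map φ volume A = volume (φ ⁻¹' A) :=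
      φ.toHomeomorph.toMeasurableEquiv.map_apply A
    rw [← h, Measure.isAddLeftInvariant_eq_smul (Measure.map φ volume)
      (volume : Measure (ℝ × ℝ × ℝ × ℝ))]
    rfl
  have hvol : volume.real (convexHull ℝ (range S.points)) = k * (1 / 24) := by
    rw [Measure.real, hS, measure_preimage_add_right, hscale, volume_simplex_four,
      ENNReal.toReal_mul, ENNReal.toReal_ofReal (by norm_num)]
    rfl
  have hcovol : ZLattice.covolume Λ volume ≤ k * (11 / 343) := by
    rw [hscale] at hle
    have h := hle.trans (mul_le_mul_right (volume_tile_le hc hf hcov) (k : ENNReal))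
    rwa [← ENNReal.ofReal_coe_nnreal, ← ENNReal.ofReal_mul k.coe_nonneg,
      ENNReal.ofReal_le_ofReal_iff (mul_nonneg k.coe_nonneg (by norm_num))] at h
  rw [coveringDensity, le_div_iff₀ (ZLattice.covolume_pos Λ volume), hvol]
  linarith

/-! ### Existence of lattice coverings -/

/-- The parallelepiped spanned by a quarter of each edge vector lies in the simplex, so the lattice
of these vectors gives a covering. -/
lemma latticeCoveringDensities_nonempty (S : Affine.Simplex ℝ (EuclideanSpace ℝ (Fin 4)) 4) :
    (latticeCoveringDensities (convexHull ℝ (range S.points))).Nonempty := by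
  obtain ⟨b, hb⟩ := exists_basis_convexHull_eq S
  let c := b.isUnitSMul (w := fun _ => (1 / 4 : ℝ)) (fun _ => by norm_num)
  have hrepr : ∀ x i, b.repr x i = 1 / 4 * c.repr x i := by
    intro x i
    simp [c, Module.Basis.repr_isUnitSMul, Units.smul_def]
  refine ⟨_, Submodule.span ℤ (range c), inferInstance, inferInstance, ?_, rfl⟩
  refine eq_univ_of_forall fun x => ?_
  refine mem_iUnion₂.2 ⟨ZSpan.floor c (x - S.points 0), Subtype.property _,
    S.points 0 + ZSpan.fract c (x - S.points 0), ?_, ?_⟩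
  · rw [hb]
    have h : ∀ i, b.repr (S.points 0 + ZSpan.fract c (x - S.points 0) - S.points 0) i =
        1 / 4 * Int.fract (c.repr (x - S.points 0) i) := by
      intro i
      rw [add_sub_cancel_left, hrepr, ZSpan.repr_fract_apply]
    refine ⟨fun i => ?_, ?_⟩
    · rw [h]
      have := Int.fract_nonneg (c.repr (x - S.points 0) i)
      positivity
    · simp only [h, Fin.sum_univ_four]
      have := fun i => (Int.fract_lt_one (c.repr (x - S.points 0) i)).le
      linarith [this 0, this 1, this 2, this 3]
  · simp only [ZSpan.fract_apply]
    abel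

theorem theorem1p2 (S : Affine.Simplex ℝ (EuclideanSpace ℝ (Fin 4)) 4) :
    (∀ (Λ : Submodule ℤ (EuclideanSpace ℝ (Fin 4))) [DiscreteTopology Λ] [IsZLattice ℝ Λ],
      IsLatticeCovering (convexHull ℝ (Set.range S.points)) Λ →
        (343 / 264 : ℝ) ≤ coveringDensity (convexHull ℝ (Set.range S.points)) Λ) ∧
    (343 / 264 : ℝ) ≤ latticeCoveringDensity (convexHull ℝ (Set.range S.points)) := by
  refine ⟨fun Λ _ _ hΛ => le_coveringDensity S Λ hΛ,
    le_csInf (latticeCoveringDensities_nonempty S) ?_⟩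
  rintro _ ⟨Λ, _, _, hΛ, rfl⟩
  exact le_coveringDensity S Λ hΛ
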